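/- Let $G$ be a finite simple $d$-regular graph with $N\ge 2$ vertices and $d\ge 1$, let $A_G$ be its normalized adjacency matrix (entry $1/d$ on edges, $0$ elsewhere), and let $g=1-\lambda_2(A_G)$ be its spectral gap, where $\lambda_2$ is the second largest eigenvalue counted with multiplicity; assume $g>0$ (i.e. $G$ is connected). Label the $d$ edges at each vertex arbitrarily by $[d]$, and let $\mathcal R_G(u,a)=(v,b)$, where $v$ is the neighbour of $u$ along the edge labelled $a$ at $u$ and $b$ is the label of this edge at $v$. For $t\ge1$ let $\mathcal R_{G^t}(u,g_1,\dots,g_t)=(v,h_1,\dots,h_t)$, where the path with edge labels $g_1,\dots,g_t$ leads from $u$ to $v$ and $h_1,\dots,h_t$ are the edge labels of the reversed path; it is the rotation map of a $d^t$-regular multigraph $G^t$. On $\mathbb C^N\otimes(\mathbb C^d)^{\otimes t}$ put $$|\psi_u^t\rangle=d^{-t/2}\sum_{\mathbf g\in[d]^t}|u,\mathbf g\rangle,\quad C_t=2\sum_u|\psi^t_u\rangle\langle\psi^t_u|-\mathbb I,\quad S_t|x\rangle=|\mathcal R_{G^t}(x)\rangle,\quad O_t=\mathbb I-2|\psi^t_m\rangle\langle\psi^t_m|,$$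 $U_t=S_tC_tO_t$, where $m$ is the marked vertex, and $|\Psi_S\rangle=N^{-1/2}\sum_u|\psi^t_u\rangle$. The success probability after $Q$ iterations is $|\langle\psi^t_m|U_t^Q|\Psi_S\rangle|^2$. $U_t^Q$ is run as a circuit in which each $O_t$ is one call of the target oracle, $S_t$ is performed by applying $\mathcal R_G$ (one call of the graph oracle) to the vertex register and the $i$-th label register for $i=1,\dots,t$ and then reversing the order of the label registers, and $C_t$ and the reversal, which touch only the label registers, need no calls. For each such $G$ there is an odd $t$ with $1/g\le t\le 3/g$. Moreover, let $0<c_1\le c_2$. There are constants $\gamma,\kappa_1,\kappa_2,p_0>0$ depending only on $c_1,c_2$, and for each $p\in(0,p_0]$ constants $a,b>0$ and $N_0$ depending only on $c_1,c_2,p$, such that for all such $G$, all edge labellings, and all odd $t$ with $c_1/g\le t\le c_2/g$: 1. The normalized adjacency matrix of $G^t$ is $A_G^t$, and its spectral gap $g_t$ satisfies $1-g_t=(1-g)^t$ and $\gamma\le g_t\le 2$, i.e. $g_t=\Theta(1)$. 2. The circuit described above performs $U_t^Q$, for every $Q$ and every $m$. 3. If $N\ge N_0$, there is a least number $Q$ of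 iterations for which the success probability is at least $p$ for every marked vertex $m$; with this $Q$, the number $Q_O$ of target-oracle calls and the number $Q_G$ of graph-oracle calls of the circuit satisfy $$a\sqrt N\le Q_O\le b\sqrt N,\qquad a\,\frac{\sqrt N}{g}\le Q_G\le b\,\frac{\sqrt N}{g}.$$ 4. The number of qubits $n=\lceil\log_2N\rceil+t\lceil\log_2d\rceil$ of the registers is logarithmic in the dimension $Nd^t$ of the state space: $\kappa_1\big(\log_2N+\tfrac{\log_2d}{g}\big)\le n\le\kappa_2\big(\log_2N+\tfrac{\log_2d}{g}\big)$; in particular $n\le\kappa_2\,\frac{\log_2N}{g}$, which is $O(\log N)$ for graphs whose gap is bounded below. -/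

import Mathlib

open scoped Matrix

universe u

section Graph

variable {V : Type u} [Fintype V] [DecidableEq V]

/-- The normalized adjacency matrix: entry `1 / d` on edges, `0` elsewhere. -/
noncomputable def normAdj (G : SimpleGraph V) [DecidableRel G.Adj] (d : ℕ) : Matrix V V ℝ :=
  Matrix.of fun u v => if G.Adj u v then 1 / (d : ℝ) else 0

/-- The spectral gap `1 - lam`, where `lam` is the second largest eigenvalue, counted with
multiplicity, of a real symmetric matrix of size at least two (`eigenvalues₀` is the decreasing
list of the eigenvalues). The value `0` in the other cases is a convention. -/
noncomputable def spectralGap (M : Matrix V V ℝ) : ℝ :=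
  open Classical in
  if h : M.IsHermitian ∧ 1 < Fintype.card V then 1 - h.1.eigenvalues₀ ⟨1, h.2⟩ else 0

end Graph

theorem normAdj_isHermitian {V : Type u} (G : SimpleGraph V) [DecidableRel G.Adj] (d : ℕ) :
    (normAdj G d).IsHermitian := by
  ext u v
  simp [normAdj, Matrix.conjTranspose_apply, G.adj_comm]

section Walk

variable {V : Type u} {G : SimpleGraph V} {d : ℕ}

/-- A labelling of the edges at every vertex by `[d]`: the neighbour of `u` along the edge which is
labelled `a` at `u` is `L u a`. Such a labelling exists exactly when the graph is `d`-regular. -/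
abbrev EdgeLabelling (G : SimpleGraph V) (d : ℕ) : Type u :=
  ∀ u : V, Fin d ≃ G.neighborSet u

/-- The rotation map of the graph: `(u, a)` goes to `(v, b)`, where `v` is the neighbour of `u`
along the edge labelled `a` at `u`, and `b` is the label of this same edge at `v`. -/
def rotationMap (L : EdgeLabelling G d) (x : V × Fin d) : V × Fin d :=
  ((L x.1 x.2 : V), (L (L x.1 x.2)).symm ⟨x.1, SimpleGraph.Adj.symm (L x.1 x.2).2⟩)

/-- The vertices of the path which starts at `u` and leaves its successive vertices along the
edges labelled `g 0, g 1, …, g (t - 1)`. -/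
def pathVertex (L : EdgeLabelling G d) {t : ℕ} (u : V) (g : Fin t → Fin d) : Fin (t + 1) → V :=
  Fin.induction u fun i w => (rotationMap L (w, g i)).1

/-- The rotation map of the powered graph `G ^ t`: `(u, g)` goes to `(v, h)`, where the path with
edge labels `g` leads from `u` to `v`, and `h` is the list of the labels of the reversed path, from
`v` to `u`. -/
def powRotationMap (L : EdgeLabelling G d) (t : ℕ) (x : V × (Fin t → Fin d)) :
    V × (Fin t → Fin d) :=
  (pathVertex L x.1 x.2 (Fin.last t),
    fun j => (rotationMap L (pathVertex L x.1 x.2 j.rev.castSucc, x.2 j.rev)).2)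

/-- One call of the rotation map, on the vertex register and the `i`-th edge-label register. -/
def rotateAt (L : EdgeLabelling G d) {t : ℕ} (i : Fin t) (x : V × (Fin t → Fin d)) :
    V × (Fin t → Fin d) :=
  ((rotationMap L (x.1, x.2 i)).1, Function.update x.2 i (rotationMap L (x.1, x.2 i)).2)

/-- Reversal of the order of the edge-label registers. -/
def reverseLabels {t : ℕ} (x : V × (Fin t → Fin d)) : V × (Fin t → Fin d) :=
  (x.1, fun j => x.2 j.rev)

variable [Fintype V] [DecidableEq V]

/-- The normalized adjacency matrix of the powered graph `G ^ t`, a `d ^ t`-regular multigraph whose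
edges are given by its rotation map. -/
noncomputable def powAdj (L : EdgeLabelling G d) (t : ℕ) : Matrix V V ℝ :=
  Matrix.of fun u v =>
    (Fintype.card {g : Fin t → Fin d // (powRotationMap L t (u, g)).1 = v} : ℝ) / (d : ℝ) ^ t

/-- The linear map sending the basis state `|x⟩` to `|r x⟩`, as a matrix. -/
def basisMap {X : Type*} [DecidableEq X] (r : X → X) : Matrix X X ℂ :=
  Matrix.of fun y x => if y = r x then 1 else 0

/-- The state `|ψ_u⟩ = d ^ (-t / 2) ∑ g, |u, g⟩`. -/
noncomputable def psi (d t : ℕ) (u : V) : V × (Fin t → Fin d) → ℂ :=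
  fun x => if x.1 = u then 1 / (Real.sqrt ((d : ℝ) ^ t) : ℂ) else 0

/-- The uniform starting state `N ^ (-1 / 2) ∑ u, |ψ_u⟩`. -/
noncomputable def startState (V : Type u) [Fintype V] [DecidableEq V] (d t : ℕ) :
    V × (Fin t → Fin d) → ℂ :=
  (1 / (Real.sqrt (Fintype.card V) : ℂ)) • ∑ u : V, psi d t u

/-- The projector `|ψ⟩⟨ψ|`. -/
def ketBra {X : Type*} (ψ : X → ℂ) : Matrix X X ℂ := Matrix.vecMulVec ψ (star ψ)

/-- The coin operator `2 ∑ u, |ψ_u⟩⟨ψ_u| - 1`. -/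
noncomputable def coinOp (V : Type u) [Fintype V] [DecidableEq V] (d t : ℕ) :
    Matrix (V × (Fin t → Fin d)) (V × (Fin t → Fin d)) ℂ :=
  (2 : ℂ) • ∑ u : V, ketBra (psi d t u) - 1

/-- The oracle `1 - 2 |ψ_m⟩⟨ψ_m|` for the marked vertex `m`. -/
noncomputable def targetOp (d t : ℕ) (m : V) :
    Matrix (V × (Fin t → Fin d)) (V × (Fin t → Fin d)) ℂ :=
  1 - (2 : ℂ) • ketBra (psi d t m)

/-- The shift operator of the powered graph. -/
def shiftOp (L : EdgeLabelling G d) (t : ℕ) :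
    Matrix (V × (Fin t → Fin d)) (V × (Fin t → Fin d)) ℂ :=
  basisMap (powRotationMap L t)

/-- The walk operator (shift after coin) on the powered graph. -/
noncomputable def walkOp (L : EdgeLabelling G d) (t : ℕ) :
    Matrix (V × (Fin t → Fin d)) (V × (Fin t → Fin d)) ℂ :=
  shiftOp L t * coinOp V d t

/-- One iteration of the multi-step search: a call of the oracle, then one step of the walk on the
powered graph. -/
noncomputable def searchOp (L : EdgeLabelling G d) (t : ℕ) (m : V) :
    Matrix (V × (Fin t → Fin d)) (V × (Fin t → Fin d)) ℂ :=
  walkOp L t * targetOp d t m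

/-- The probability to find the target state `|ψ_m⟩` after `Q` iterations from the uniform starting
state. -/
noncomputable def successProb (L : EdgeLabelling G d) (t : ℕ) (m : V) (Q : ℕ) : ℝ :=
  ‖star (psi d t m) ⬝ᵥ ((searchOp L t m) ^ Q *ᵥ startState V d t)‖ ^ 2

/-- The gates, on one vertex register and `t` edge-label registers: a call of the target oracle, a
call of the graph oracle (the rotation map of `G`) on the vertex register and the `i`-th label
register, and two gates without calls, which touch the label registers only: the coin, and the
reversal of the order of the label registers. -/
inductive Gate (t : ℕ) : Type
  | target : Gate t
  | graph (i : Fin t) : Gate t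
  | coin : Gate t
  | reverse : Gate t

/-- The operator that a gate performs. -/
noncomputable def Gate.op (L : EdgeLabelling G d) {t : ℕ} (m : V) :
    Gate t → Matrix (V × (Fin t → Fin d)) (V × (Fin t → Fin d)) ℂ
  | .target => targetOp d t m
  | .graph i => basisMap (rotateAt L i)
  | .coin => coinOp V d t
  | .reverse => basisMap reverseLabels

/-- The operator that a circuit performs; the head of the list is applied first. -/
noncomputable def circuitOp (L : EdgeLabelling G d) {t : ℕ} (m : V) :
    List (Gate t) → Matrix (V × (Fin t → Fin d)) (V × (Fin t → Fin d)) ℂ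
  | [] => 1
  | a :: c => circuitOp L m c * a.op L m

end Walk

/-- Number of calls of the target oracle in a circuit. -/
def targetCalls {t : ℕ} : List (Gate t) → ℕ
  | [] => 0
  | .target :: c => targetCalls c + 1
  | _ :: c => targetCalls c

/-- Number of calls of the graph oracle in a circuit. -/
def graphCalls {t : ℕ} : List (Gate t) → ℕ
  | [] => 0
  | .graph _ :: c => graphCalls c + 1
  | _ :: c => graphCalls c

/-- The circuit of `Q` iterations of the multi-step search. It knows neither the graph nor the
marked vertex. -/
def searchCircuit (t Q : ℕ) : List (Gate t) :=
  (List.replicate Q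
    ([Gate.target, Gate.coin] ++ List.ofFn Gate.graph ++ [Gate.reverse])).flatten

/-- Number of qubits that hold one vertex register (`N` values) and `t` edge-label registers (`d`
values each). -/
def qubitCount (N d t : ℕ) : ℕ := Nat.clog 2 N + t * Nat.clog 2 d

/-! Gap amplification. For odd `t` the map `x ↦ x ^ t` is increasing, so it keeps the eigenvalues of
the normalized adjacency matrix in order, and the gap of the power is `1 - (1 - g) ^ t`. With `t ≥
c₁ / g` this is at least `γ = 1 - exp (-c₁)`. It then suffices to show that a walk with gap at least
`γ` reaches a constant success probability after order `√N` iterations, and no sooner; each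
iteration costs one target call and `t` graph calls.

Lower bound (`successProb_le`): the walk fixes the uniform state and the oracle moves it by only `2
/ √N`, so by unitarity the target amplitude grows at most linearly.

Upper bound (`le_norm_amplitude`): no eigenphases of `U` are computed; an explicit approximate orbit
is compared with the true one. Let `P` be the adjacency matrix of the power and `f` the mean-zero
solution of `f - P f = (δ_m - 1/N) / 2`. Write `r = 1 / √N`, `Ψ` for the start, `A` for the lift of
`f`, `B = S A`, and `k = 1 / (2 f m)`. The vector `w = 2A - 2B + rΨ` has target amplitude `1` and
satisfies `U w = w - 2rΨ`. Moreover `U` sends `Ψ - 2krA` to itself plus `kr w - kr²Ψ`. So the orbit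
follows `(Ψ - 2krA) + kjr w`, whose target amplitude is exactly `kjr`, with error of order `kr²j`
per step. The gap enters through `poisson_solution_bounds`: it gives `k ≥ γ` and makes the initial
error `2kr‖f‖` of order `1 / (γ√N)`. All estimates are uniform in `m`, so one `Q` serves every
marked vertex. -/

/-! ### Eigenvalues of odd powers -/

open Matrix in
/-- The eigenvalues of a power of a Hermitian real matrix, as roots of the characteristic
polynomial. -/
theorem Matrix.IsHermitian.roots_charpoly_pow {V : Type*} [Fintype V] [DecidableEq V]
    {M : Matrix V V ℝ} (hM : M.IsHermitian) (t : ℕ) :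
    (M ^ t).charpoly.roots = Multiset.map (fun i => hM.eigenvalues₀ i ^ t) Finset.univ.val := by
  have h1 : (M ^ t).charpoly = ∏ i, (Polynomial.X - Polynomial.C (hM.eigenvalues i ^ t)) := by
    conv_lhs => rw [hM.spectral_theorem, ← map_pow, Unitary.conjStarAlgAut_apply,
      charpoly_mul_comm, ← mul_assoc]
    simp [charpoly_diagonal, diagonal_pow]
  have h2 : (M ^ t).charpoly.roots =
      Multiset.map (fun i => hM.eigenvalues i ^ t) Finset.univ.val := by
    rw [h1, Polynomial.roots_prod]
    · simp [-map_pow]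
    · simp [-map_pow, Finset.prod_ne_zero_iff, Polynomial.X_sub_C_ne_zero]
  rw [h2]
  have h3 := hM.roots_charpoly_eq_eigenvalues
  rw [hM.roots_charpoly_eq_eigenvalues₀] at h3
  have h4 := congrArg (Multiset.map (fun x : ℝ => x ^ t)) h3
  simpa [Multiset.map_map, Function.comp_def] using h4.symm

/-- Odd powers preserve the order of the eigenvalues of a Hermitian real matrix. -/
theorem Matrix.IsHermitian.eigenvalues₀_pow {V : Type*} [Fintype V] [DecidableEq V]
    {M : Matrix V V ℝ} (hM : M.IsHermitian) {t : ℕ} (ht : Odd t) (hMt : (M ^ t).IsHermitian)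
    (i : Fin (Fintype.card V)) : hMt.eigenvalues₀ i = hM.eigenvalues₀ i ^ t := by
  have h1 := hM.roots_charpoly_pow t
  rw [hMt.roots_charpoly_eq_eigenvalues₀] at h1
  have hanti : Antitone fun i => hM.eigenvalues₀ i ^ t := fun i j hij =>
    ht.strictMono_pow.monotone (hM.eigenvalues₀_antitone hij)
  have h2 : List.ofFn hMt.eigenvalues₀ = List.ofFn fun i => hM.eigenvalues₀ i ^ t := by
    -- Two decreasing lists with the same multiset of entries coincide; oddness is what makes the
    -- list of powers decreasing.
    refine List.Perm.eq_of_pairwise' (r := (· ≥ ·)) ?_ ?_ ?_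
    · exact List.sortedGE_iff_pairwise.1 hMt.eigenvalues₀_antitone.sortedGE_ofFn
    · exact List.sortedGE_iff_pairwise.1 hanti.sortedGE_ofFn
    · rw [Fin.univ_val_map, Fin.univ_val_map, Multiset.coe_eq_coe] at h1
      simpa [Function.comp_def] using h1
  exact congrFun (List.ofFn_injective h2) i

/-! ### Spectral gap and the Poisson equation -/

section Spectral

variable {V : Type u} [Fintype V] [DecidableEq V]

theorem spectralGap_of_isHermitian {M : Matrix V V ℝ} (hM : M.IsHermitian)
    (hc : 1 < Fintype.card V) : spectralGap M = 1 - hM.eigenvalues₀ ⟨1, hc⟩ := by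
  rw [spectralGap, dif_pos ⟨hM, hc⟩]

theorem one_sub_spectralGap_pow {M : Matrix V V ℝ} (hM : M.IsHermitian)
    (hc : 1 < Fintype.card V) {t : ℕ} (ht : Odd t) :
    1 - spectralGap (M ^ t) = (1 - spectralGap M) ^ t := by
  rw [spectralGap_of_isHermitian (hM.pow t) hc, spectralGap_of_isHermitian hM hc,
    hM.eigenvalues₀_pow ht]
  ring

/-- Parseval's identity for the eigenvector basis. -/
theorem dotProduct_eq_sum_eigenvectorBasis {M : Matrix V V ℝ} (hM : M.IsHermitian) (x y : V → ℝ) :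
    x ⬝ᵥ y = ∑ i, (x ⬝ᵥ ⇑(hM.eigenvectorBasis i)) * (⇑(hM.eigenvectorBasis i) ⬝ᵥ y) := by
  have := hM.eigenvectorBasis.sum_inner_mul_inner (WithLp.toLp 2 x) (WithLp.toLp 2 y)
  simp only [EuclideanSpace.inner_eq_star_dotProduct, star_trivial] at this
  rw [dotProduct_comm x y, ← this]
  refine Finset.sum_congr rfl fun i _ => ?_
  rw [dotProduct_comm x, dotProduct_comm y]

theorem eigenvectorBasis_dotProduct_mulVec {M : Matrix V V ℝ} (hM : M.IsHermitian) (i : V)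
    (x : V → ℝ) : ⇑(hM.eigenvectorBasis i) ⬝ᵥ (M *ᵥ x) =
      hM.eigenvalues i * (⇑(hM.eigenvectorBasis i) ⬝ᵥ x) := by
  have hT : Mᵀ = M := by simpa [Matrix.IsHermitian] using hM
  rw [Matrix.dotProduct_mulVec, ← Matrix.mulVec_transpose, hT, hM.mulVec_eigenvectorBasis,
    smul_dotProduct, smul_eq_mul]

/-- On the orthogonal complement of the constant functions the quadratic form of a symmetric matrix
with row sums one is bounded by the second eigenvalue. -/
theorem dotProduct_mulVec_le_of_spectralGap_pos {M : Matrix V V ℝ} (hM : M.IsHermitian)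
    (hc : 1 < Fintype.card V) (h1 : M *ᵥ 1 = 1) (hg : 0 < spectralGap M) {f : V → ℝ}
    (hf : f ⬝ᵥ 1 = 0) : f ⬝ᵥ (M *ᵥ f) ≤ (1 - spectralGap M) * (f ⬝ᵥ f) := by
  set e := fun i => ⇑(hM.eigenvectorBasis i) with he
  set σ := (Fintype.equivOfCardEq (Fintype.card_fin (Fintype.card V)) :
    Fin (Fintype.card V) ≃ V) with hσ
  -- The index of the largest eigenvalue. Every other eigenvalue is below `1`, so its eigenvector is
  -- orthogonal to the fixed vector `1`. Hence `1` is a multiple of `e i₀`, and `f ⟂ 1` gives `f ⟂ e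
  -- i₀`; the top eigenvalue itself is never needed.
  set i₀ : V := σ ⟨0, by omega⟩ with hi₀
  have hle : ∀ i, i ≠ i₀ → hM.eigenvalues i ≤ 1 - spectralGap M := by
    intro i hi
    rw [spectralGap_of_isHermitian hM hc, sub_sub_cancel]
    refine hM.eigenvalues₀_antitone ?_
    rw [Fin.le_def]
    by_contra hlt
    push Not at hlt
    apply hi
    rw [hi₀, ← Equiv.symm_apply_eq]
    ext
    simpa using hlt
  have hz : ∀ i, i ≠ i₀ → e i ⬝ᵥ 1 = 0 := by
    intro i hi
    have h := eigenvectorBasis_dotProduct_mulVec hM i 1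
    rw [h1] at h
    have h2 := hle i hi
    have h3 : (1 - hM.eigenvalues i) * (e i ⬝ᵥ 1) = 0 := by
      rw [sub_mul, one_mul]; linarith
    rcases mul_eq_zero.1 h3 with h4 | h4
    · linarith
    · exact h4
  have hone : (1 : V → ℝ) ⬝ᵥ 1 = (1 ⬝ᵥ e i₀) * (e i₀ ⬝ᵥ 1) := by
    rw [dotProduct_eq_sum_eigenvectorBasis hM]
    refine Finset.sum_eq_single i₀ (fun i _ hi => ?_) (by simp)
    rw [show ⇑(hM.eigenvectorBasis i) ⬝ᵥ 1 = 0 from hz i hi, mul_zero]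
  have hfz : f ⬝ᵥ e i₀ = 0 := by
    rw [dotProduct_eq_sum_eigenvectorBasis hM, Finset.sum_eq_single i₀] at hf
    · rcases mul_eq_zero.1 hf with h | h
      · exact h
      · rw [show e i₀ ⬝ᵥ 1 = 0 from h, mul_zero] at hone
        simp at hone
        omega
    · intro i _ hi
      rw [show ⇑(hM.eigenvectorBasis i) ⬝ᵥ 1 = 0 from hz i hi, mul_zero]
    · simp
  rw [dotProduct_eq_sum_eigenvectorBasis hM f (M *ᵥ f), dotProduct_eq_sum_eigenvectorBasis hM f f,
    Finset.mul_sum]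
  refine Finset.sum_le_sum fun i _ => ?_
  rw [eigenvectorBasis_dotProduct_mulVec]
  by_cases hi : i = i₀
  · rw [hi, show f ⬝ᵥ ⇑(hM.eigenvectorBasis i₀) = 0 from hfz]
    simp
  · have h5 := hle i hi
    rw [dotProduct_comm (⇑(hM.eigenvectorBasis i)) f]
    nlinarith [mul_self_nonneg (f ⬝ᵥ ⇑(hM.eigenvectorBasis i))]

/-- The spectral gap of a symmetric stochastic matrix is at most two. -/
theorem spectralGap_le_two {M : Matrix V V ℝ} (hM : M.IsHermitian)
    (hc : 1 < Fintype.card V) (h1 : M *ᵥ 1 = 1) (h0 : ∀ u v, 0 ≤ M u v) :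
    spectralGap M ≤ 2 := by
  rw [spectralGap_of_isHermitian hM hc]
  obtain ⟨i, hi⟩ : ∃ i, hM.eigenvalues i = hM.eigenvalues₀ ⟨1, hc⟩ :=
    ⟨Fintype.equivOfCardEq (Fintype.card_fin _) ⟨1, hc⟩, by simp [Matrix.IsHermitian.eigenvalues]⟩
  rw [← hi]
  set e : V → ℝ := ⇑(hM.eigenvectorBasis i) with he
  have hee : ∑ u, e u ^ 2 = 1 := by
    have := hM.eigenvectorBasis.orthonormal.1 i
    rw [EuclideanSpace.norm_eq, Real.sqrt_eq_one] at this
    simpa using this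
  have hrow : ∀ u, ∑ v, M u v = 1 := fun u => by
    simpa [Matrix.mulVec, dotProduct] using congrFun h1 u
  have hsymm : ∀ u v, M u v = M v u := fun u v => by
    simpa using (hM.apply v u)
  have hev : ∑ u, ∑ v, M u v * (e u * e v) = hM.eigenvalues i := by
    have h := eigenvectorBasis_dotProduct_mulVec hM i e
    rw [← he] at h
    have h2 : e ⬝ᵥ e = 1 := by rw [← hee]; simp [dotProduct, sq]
    rw [h2, mul_one] at h
    rw [← h]
    simp only [dotProduct, Matrix.mulVec, Finset.mul_sum]
    exact Finset.sum_congr rfl fun u _ => Finset.sum_congr rfl fun v _ => by ring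
  have hr : ∑ u, ∑ v, M u v * e u ^ 2 = 1 := by
    simp_rw [← Finset.sum_mul, hrow, one_mul, hee]
  have hcol : ∑ u, ∑ v, M u v * e v ^ 2 = 1 := by
    rw [Finset.sum_comm, ← hr]
    exact Finset.sum_congr rfl fun u _ => Finset.sum_congr rfl fun v _ => by rw [hsymm]
  -- For a unit eigenvector this sum equals `2 + 2λ`, so `λ ≥ -1`.
  have hpos : 0 ≤ ∑ u, ∑ v, M u v * (e u + e v) ^ 2 :=
    Finset.sum_nonneg fun u _ => Finset.sum_nonneg fun v _ => mul_nonneg (h0 u v) (sq_nonneg _)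
  have hexp : ∑ u, ∑ v, M u v * (e u + e v) ^ 2 =
      ∑ u, ∑ v, M u v * e u ^ 2 + ∑ u, ∑ v, M u v * e v ^ 2 +
        2 * ∑ u, ∑ v, M u v * (e u * e v) := by
    simp only [Finset.mul_sum, ← Finset.sum_add_distrib]
    exact Finset.sum_congr rfl fun u _ => Finset.sum_congr rfl fun v _ => by ring
  linarith

/-- The solution of the Poisson equation with source at one point. -/
theorem exists_poisson_solution {M : Matrix V V ℝ} (hM : M.IsHermitian)
    (hc : 1 < Fintype.card V) (h1 : M *ᵥ 1 = 1) (hg : 0 < spectralGap M) (m : V) :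
    ∃ f : V → ℝ, f ⬝ᵥ 1 = 0 ∧
      f - M *ᵥ f = fun u => ((if u = m then 1 else 0) - 1 / (Fintype.card V : ℝ)) / 2 := by
  have hT : Mᵀ = M := by simpa [Matrix.IsHermitian] using hM
  have hN : (Fintype.card V : ℝ) ≠ 0 := by
    have : Fintype.card V ≠ 0 := by omega
    exact_mod_cast this
  have hsum : ∀ f : V → ℝ, (M *ᵥ f) ⬝ᵥ 1 = f ⬝ᵥ 1 := fun f => by
    rw [dotProduct_comm, Matrix.dotProduct_mulVec, ← Matrix.mulVec_transpose, hT, h1,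
      dotProduct_comm]
  -- `1 - M` kills the constants; adding `f ↦ (∑ f) 1` makes it injective, hence surjective, and
  -- does not change it on mean-zero functions. The source has mean zero, so the solution does too.
  let B : (V → ℝ) →ₗ[ℝ] (V → ℝ) := LinearMap.id - M.mulVecLin +
    { toFun := fun f _ => f ⬝ᵥ 1
      map_add' := fun f g => by ext; simp [add_dotProduct]
      map_smul' := fun c f => by ext; simp [smul_dotProduct] }
  have hB : ∀ f, B f = f - M *ᵥ f + fun _ => f ⬝ᵥ 1 := fun f => rfl
  have hBsum : ∀ f, B f ⬝ᵥ 1 = Fintype.card V * (f ⬝ᵥ 1) := fun f => by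
    rw [hB, add_dotProduct, sub_dotProduct, hsum, sub_self, zero_add]
    simp [dotProduct]
  have hinj : Function.Injective B := by
    rw [injective_iff_map_eq_zero]
    intro f hf
    have hf1 : f ⬝ᵥ 1 = 0 := by
      have := hBsum f
      rw [hf, zero_dotProduct] at this
      rcases mul_eq_zero.1 this.symm with h | h
      · exact absurd h hN
      · exact h
    have h2 := dotProduct_mulVec_le_of_spectralGap_pos hM hc h1 hg hf1
    rw [hB, hf1] at hf
    have h3 : M *ᵥ f = f := by
      ext u
      have := congrFun hf u
      simp at this
      linarith
    rw [h3] at h2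
    have h4 : f ⬝ᵥ f ≤ 0 := by nlinarith
    have h5 : 0 ≤ f ⬝ᵥ f := Finset.sum_nonneg fun u _ => mul_self_nonneg _
    exact dotProduct_self_eq_zero.1 (le_antisymm h4 h5)
  obtain ⟨f, hf⟩ := LinearMap.injective_iff_surjective.1 hinj
    fun u => ((if u = m then 1 else 0) - 1 / (Fintype.card V : ℝ)) / 2
  have hf1 : f ⬝ᵥ 1 = 0 := by
    have := hBsum f
    rw [hf] at this
    have h0 : (fun u => ((if u = m then (1 : ℝ) else 0) - 1 / (Fintype.card V : ℝ)) / 2) ⬝ᵥ 1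
        = 0 := by
      simp only [dotProduct, Pi.one_apply, mul_one, ← Finset.sum_div, Finset.sum_sub_distrib]
      simp [hN]
    rw [h0] at this
    rcases mul_eq_zero.1 this.symm with h | h
    · exact absurd h hN
    · exact h
  refine ⟨f, hf1, ?_⟩
  rw [← hf, hB, hf1]
  ext
  simp

/-- Bounds for the solution of the Poisson equation with source at one point. -/
theorem poisson_solution_bounds {M : Matrix V V ℝ} (hM : M.IsHermitian)
    (hc : 1 < Fintype.card V) (h1 : M *ᵥ 1 = 1) (h0 : ∀ u v, 0 ≤ M u v) {γ : ℝ} (hγ : 0 < γ)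
    (hg : γ ≤ spectralGap M) {m : V} {f : V → ℝ} (hf1 : f ⬝ᵥ 1 = 0)
    (hf : f - M *ᵥ f = fun u => ((if u = m then 1 else 0) - 1 / (Fintype.card V : ℝ)) / 2) :
    0 < f m ∧ f m ≤ 1 / (2 * γ) ∧ √(f ⬝ᵥ f) ≤ 4 / γ * f m := by
  have hgap := dotProduct_mulVec_le_of_spectralGap_pos hM hc h1 (hγ.trans_le hg) hf1
  set F := √(f ⬝ᵥ f) with hF
  have hff : 0 ≤ f ⬝ᵥ f := Finset.sum_nonneg fun u _ => mul_self_nonneg _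
  have hFF : F ^ 2 = f ⬝ᵥ f := Real.sq_sqrt hff
  have hF0 : 0 ≤ F := Real.sqrt_nonneg _
  have habs : ∀ v, |f v| ≤ F := fun v => by
    rw [hF, ← Real.sqrt_sq_eq_abs]
    refine Real.sqrt_le_sqrt ?_
    rw [dotProduct, sq]
    exact Finset.single_le_sum (f := fun u => f u * f u) (fun u _ => mul_self_nonneg _)
      (Finset.mem_univ v)
  have hrow : ∑ v, M m v = 1 := by
    simpa [Matrix.mulVec, dotProduct] using congrFun h1 m
  have hMf : -F ≤ (M *ᵥ f) m := by
    rw [Matrix.mulVec, dotProduct, ← mul_one (-F), ← hrow, Finset.mul_sum]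
    refine Finset.sum_le_sum fun v _ => ?_
    have := (abs_le.1 (habs v)).1
    nlinarith [h0 m v]
  have hN2 : (2 : ℝ) ≤ Fintype.card V := by exact_mod_cast hc
  have hN : 1 / (Fintype.card V : ℝ) ≤ 1 / 2 := one_div_le_one_div_of_le (by norm_num) hN2
  have hm := congrFun hf m
  simp only [Pi.sub_apply, if_true] at hm
  -- At `m` the source is at least `1 / 4` because `N ≥ 2`, while `f m - (M f) m ≤ 2F`, as `(M f) m`
  -- is an average of values of `f`.
  have hF8 : 1 / 8 ≤ F := by
    have := (abs_le.1 (habs m)).2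
    linarith
  -- Pair the Poisson equation with `f`: the constant part of the source drops out. The gap then
  -- gives `f m ≥ 2γF²`; with `f m ≤ F` and `F ≥ 1 / 8` this yields all three bounds.
  have hH : f m = 2 * (f ⬝ᵥ f - f ⬝ᵥ (M *ᵥ f)) := by
    rw [← dotProduct_sub, hf]
    simp only [dotProduct, mul_div_assoc', ← Finset.sum_div, mul_sub, Finset.sum_sub_distrib,
      ← Finset.sum_mul]
    have : ∑ i, f i = 0 := by simpa [dotProduct] using hf1
    simp [this]
  have hH2 : 2 * γ * F ^ 2 ≤ f m := by
    rw [hFF, hH]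
    nlinarith
  have hHF : f m ≤ F := (abs_le.1 (habs m)).2
  have hF2 : F * (2 * γ) ≤ 1 := by
    by_contra h
    push Not at h
    nlinarith
  refine ⟨?_, ?_, ?_⟩
  · have : 0 < 2 * γ * F ^ 2 := by positivity
    linarith
  · rw [le_div_iff₀ (by positivity)]
    nlinarith
  · rw [div_mul_eq_mul_div, le_div_iff₀ hγ]
    nlinarith [mul_pos hγ (by linarith : 0 < F)]

end Spectral

/-! ### Rotation maps of the graph and of its powers -/

section Rotation

variable {V : Type u} {G : SimpleGraph V} {d : ℕ} (L : EdgeLabelling G d)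

/-- The right-hand side is symmetric under exchanging `(u, a)` and `(v, b)`, which makes the
rotation map an involution. -/
theorem rotationMap_eq_iff {u v : V} {a b : Fin d} :
    rotationMap L (u, a) = (v, b) ↔ (L u a : V) = v ∧ (L v b : V) = u := by
  constructor
  · intro h
    obtain ⟨rfl, rfl⟩ := Prod.mk.inj h
    exact ⟨rfl, by simp⟩
  · rintro ⟨rfl, h⟩
    refine Prod.ext rfl ?_
    simp only [rotationMap]
    rw [Equiv.symm_apply_eq]
    exact Subtype.ext h.symm

theorem rotationMap_involutive : Function.Involutive (rotationMap L) := by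
  rintro ⟨u, a⟩
  have h := (rotationMap_eq_iff L (u := u) (a := a)).1 rfl
  exact (rotationMap_eq_iff L).2 h.symm

theorem pathVertex_succ {t : ℕ} (u : V) (g : Fin t → Fin d) (i : Fin t) :
    pathVertex L u g i.succ = (rotationMap L (pathVertex L u g i.castSucc, g i)).1 := rfl

theorem pathVertex_cons {t : ℕ} (u : V) (a : Fin d) (g : Fin t → Fin d) (i : Fin (t + 1)) :
    pathVertex L u (Fin.cons a g : Fin (t + 1) → Fin d) i.succ =
      pathVertex L (L u a : V) g i := by
  induction i using Fin.induction with
  | zero => rfl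
  | succ i ih =>
    rw [pathVertex_succ, pathVertex_succ, Fin.castSucc_succ, ih, Fin.cons_succ]

/-- Each backward label undoes one forward step because the rotation map is an involution, so the
returned labels retrace the path. -/
theorem pathVertex_powRotationMap {t : ℕ} (u : V) (g : Fin t → Fin d) (j : Fin (t + 1)) :
    pathVertex L (powRotationMap L t (u, g)).1 (powRotationMap L t (u, g)).2 j =
      pathVertex L u g j.rev := by
  induction j using Fin.induction with
  | zero => rw [Fin.rev_zero]; rfl
  | succ i ih =>
    rw [pathVertex_succ, ih, Fin.rev_castSucc, Fin.rev_succ, pathVertex_succ]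
    exact congrArg Prod.fst (rotationMap_involutive L _)

theorem powRotationMap_involutive (t : ℕ) : Function.Involutive (powRotationMap L t) := by
  rintro ⟨u, g⟩
  refine Prod.ext ?_ ?_
  · refine (pathVertex_powRotationMap L u g (Fin.last t)).trans ?_
    rw [Fin.rev_last]
    rfl
  · funext j
    have h := congrArg Prod.snd (rotationMap_involutive L (pathVertex L u g j.castSucc, g j))
    refine Eq.trans ?_ h
    change (rotationMap L (pathVertex L (powRotationMap L t (u, g)).1 (powRotationMap L t (u, g)).2
      j.rev.castSucc, _)).2 = _
    rw [pathVertex_powRotationMap, Fin.rev_castSucc, Fin.rev_rev, pathVertex_succ]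
    change (rotationMap L (_, (rotationMap L (pathVertex L u g j.rev.rev.castSucc, g j.rev.rev)).2)).2
      = _
    rw [Fin.rev_rev]

/-- Loop invariant of the graph calls: the vertex register walks along the path, and each register
already visited holds its backward label. These stand in forward order, hence the final reversal. -/
theorem foldl_rotateAt {t : ℕ} (u : V) (g : Fin t → Fin d) (k : ℕ) (hk : k ≤ t) :
    ((List.finRange t).take k).foldl (fun x i => rotateAt L i x) (u, g) =
      (pathVertex L u g ⟨k, by omega⟩, fun i : Fin t =>
        if (i : ℕ) < k then (rotationMap L (pathVertex L u g i.castSucc, g i)).2 else g i) := by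
  induction k with
  | zero => simp; rfl
  | succ k ih =>
    have hlen : k < (List.finRange t).length := by simp; omega
    rw [← List.take_concat_get' _ _ hlen, List.foldl_append, ih (by omega)]
    simp only [List.getElem_finRange, List.foldl_cons, List.foldl_nil, rotateAt]
    refine Prod.ext ?_ ?_
    · simp only [Fin.val_cast, lt_irrefl, if_false]
      exact (pathVertex_succ L u g ⟨k, by omega⟩).symm
    · funext i
      rcases eq_or_ne i ⟨k, by omega⟩ with rfl | hi
      · simp
      · have hi' : (i : ℕ) ≠ k := fun h => hi (Fin.ext h)
        have : (i : ℕ) < k + 1 ↔ (i : ℕ) < k := by omega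
        simp [Function.update_of_ne, hi, this]

theorem powRotationMap_eq {t : ℕ} (x : V × (Fin t → Fin d)) :
    powRotationMap L t x =
      reverseLabels ((List.finRange t).foldl (fun x i => rotateAt L i x) x) := by
  have h := foldl_rotateAt L x.1 x.2 t le_rfl
  rw [List.take_of_length_le (by simp)] at h
  rw [h]
  simp only [reverseLabels, powRotationMap, Fin.last, Fin.is_lt, if_true]

end Rotation

/-! ### Operators that permute the basis -/

section BasisMap

variable {X : Type*} [DecidableEq X]

theorem basisMap_mul [Fintype X] (r s : X → X) : basisMap r * basisMap s = basisMap (r ∘ s) := by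
  ext y x
  simp [basisMap, Matrix.mul_apply]

theorem basisMap_id : basisMap (id : X → X) = 1 := by
  ext y x
  simp [basisMap, Matrix.one_apply]

theorem basisMap_mulVec [Fintype X] {r : X → X} (hr : Function.Involutive r) (v : X → ℂ) (x : X) :
    (basisMap r *ᵥ v) x = v (r x) := by
  have h : ∀ y, (x = r y) ↔ (y = r x) := fun y =>
    ⟨fun h => by rw [h, hr], fun h => by rw [h, hr]⟩
  simp [basisMap, Matrix.mulVec, dotProduct, h]

theorem basisMap_conjTranspose {r : X → X} (hr : Function.Involutive r) :
    (basisMap r)ᴴ = basisMap r := by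
  have h : ∀ x y, (x = r y) ↔ (y = r x) := fun x y =>
    ⟨fun h => by rw [h, hr], fun h => by rw [h, hr]⟩
  ext x y
  simp only [basisMap, Matrix.conjTranspose_apply, Matrix.of_apply, h x y]
  split_ifs <;> simp

theorem basisMap_mem_unitaryGroup [Fintype X] {r : X → X} (hr : Function.Involutive r) :
    basisMap r ∈ Matrix.unitaryGroup X ℂ := by
  rw [Matrix.mem_unitaryGroup_iff', Matrix.star_eq_conjTranspose, basisMap_conjTranspose hr,
    basisMap_mul, hr.comp_self, basisMap_id]

end BasisMap

/-! ### Correctness of the circuit and call counts -/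

section Circuit

variable {V : Type u} [Fintype V] [DecidableEq V] {G : SimpleGraph V} {d : ℕ}
  (L : EdgeLabelling G d) {t : ℕ} (m : V)

theorem circuitOp_append (c c' : List (Gate t)) :
    circuitOp L m (c ++ c') = circuitOp L m c' * circuitOp L m c := by
  induction c with
  | nil => simp [circuitOp]
  | cons a c ih => simp [circuitOp, ih, mul_assoc]

theorem circuitOp_map_graph (l : List (Fin t)) :
    circuitOp L m (l.map Gate.graph) =
      basisMap fun x => l.foldl (fun x i => rotateAt L i x) x := by
  induction l with
  | nil => exact basisMap_id.symm
  | cons i l ih =>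
    simp only [List.map_cons, circuitOp, ih, Gate.op, basisMap_mul]
    rfl

theorem circuitOp_searchCircuit (Q : ℕ) :
    circuitOp L m (searchCircuit t Q) = searchOp L t m ^ Q := by
  have hstep : circuitOp L m ([Gate.target, Gate.coin] ++ List.ofFn Gate.graph ++ [Gate.reverse]) =
      searchOp L t m := by
    rw [circuitOp_append, circuitOp_append, List.ofFn_eq_map, circuitOp_map_graph]
    simp only [circuitOp, Gate.op, one_mul]
    rw [← mul_assoc, basisMap_mul, searchOp, walkOp, shiftOp, mul_assoc]
    congr 2
    exact funext fun x => (powRotationMap_eq L x).symm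
  induction Q with
  | zero => simp [searchCircuit, circuitOp]
  | succ Q ih =>
    rw [pow_succ, ← ih, ← hstep, ← circuitOp_append]
    rfl

end Circuit

theorem targetCalls_append {t : ℕ} (c c' : List (Gate t)) :
    targetCalls (c ++ c') = targetCalls c + targetCalls c' := by
  induction c with
  | nil => simp [targetCalls]
  | cons a c ih => cases a <;> simp [targetCalls, ih] <;> omega

theorem graphCalls_append {t : ℕ} (c c' : List (Gate t)) :
    graphCalls (c ++ c') = graphCalls c + graphCalls c' := by
  induction c with
  | nil => simp [graphCalls]
  | cons a c ih => cases a <;> simp [graphCalls, ih] <;> omega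

theorem targetCalls_map_graph {t : ℕ} (l : List (Fin t)) :
    targetCalls (l.map Gate.graph) = 0 := by
  induction l with
  | nil => rfl
  | cons i l ih => simpa [targetCalls] using ih

theorem graphCalls_map_graph {t : ℕ} (l : List (Fin t)) :
    graphCalls (l.map Gate.graph) = l.length := by
  induction l with
  | nil => rfl
  | cons i l ih => simpa [graphCalls] using ih

theorem targetCalls_searchCircuit (t Q : ℕ) : targetCalls (searchCircuit t Q) = Q := by
  induction Q with
  | zero => rfl
  | succ Q ih =>
    rw [searchCircuit, List.replicate_succ, List.flatten_cons, targetCalls_append,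
      ← searchCircuit, ih, targetCalls_append, targetCalls_append, List.ofFn_eq_map,
      targetCalls_map_graph]
    simp only [targetCalls]
    omega

theorem graphCalls_searchCircuit (t Q : ℕ) : graphCalls (searchCircuit t Q) = Q * t := by
  induction Q with
  | zero => simp [searchCircuit, graphCalls]
  | succ Q ih =>
    rw [searchCircuit, List.replicate_succ, List.flatten_cons, graphCalls_append,
      ← searchCircuit, ih, graphCalls_append, graphCalls_append, List.ofFn_eq_map,
      graphCalls_map_graph]
    simp [graphCalls]
    ring

/-! ### The adjacency matrix of the powered graph -/

section PowAdj

variable {V : Type u} [Fintype V] [DecidableEq V] {G : SimpleGraph V} {d : ℕ}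
  (L : EdgeLabelling G d)

theorem normAdj_mulVec [DecidableRel G.Adj] (f : V → ℝ) (u : V) :
    (normAdj G d *ᵥ f) u = (∑ a : Fin d, f (L u a)) / d := by
  rw [(L u).sum_comp (fun w => f w)]
  simp only [normAdj, Matrix.mulVec, dotProduct, Matrix.of_apply, ite_mul, zero_mul]
  rw [← Finset.sum_filter, Finset.sum_div]
  rw [Finset.sum_subtype (p := fun w => w ∈ G.neighborSet u) _ (by simp)]
  exact Finset.sum_congr rfl fun w _ => by ring

theorem powAdj_mulVec (t : ℕ) (f : V → ℝ) (u : V) :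
    (powAdj L t *ᵥ f) u =
      (∑ g : Fin t → Fin d, f (powRotationMap L t (u, g)).1) / (d : ℝ) ^ t := by
  simp only [powAdj, Matrix.mulVec, dotProduct, Matrix.of_apply, Fintype.card_subtype]
  simp only [div_mul_eq_mul_div, ← Finset.sum_div]
  congr 1
  simp only [Finset.card_filter, Nat.cast_sum, Finset.sum_mul]
  rw [Finset.sum_comm]
  simp

theorem powAdj_eq [DecidableRel G.Adj] (t : ℕ) : powAdj L t = normAdj G d ^ t := by
  have h : ∀ f : V → ℝ, powAdj L t *ᵥ f = normAdj G d ^ t *ᵥ f := by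
    induction t with
    | zero =>
      intro f
      ext u
      rw [powAdj_mulVec]
      simp [powRotationMap, pathVertex]
    | succ t ih =>
      intro f
      rw [pow_succ', ← Matrix.mulVec_mulVec, ← ih]
      ext u
      -- Splitting off the first label turns the average over paths of length `t + 1` into an
      -- average over neighbours of averages over paths of length `t`.
      rw [normAdj_mulVec L, powAdj_mulVec, ← (Fin.consEquiv fun _ => Fin d).sum_comp,
        Fintype.sum_prod_type]
      simp only [powAdj_mulVec, ← Finset.sum_div]
      rw [div_div, pow_succ]
      congr 1
      refine Finset.sum_congr rfl fun a _ => Finset.sum_congr rfl fun g _ => ?_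
      congr 1
      exact pathVertex_cons L u a g (Fin.last t)
  ext u v
  simpa using congrFun (h (Pi.single v 1)) u

theorem powAdj_nonneg (t : ℕ) (u v : V) : 0 ≤ powAdj L t u v := by
  simp only [powAdj, Matrix.of_apply]
  positivity

theorem powAdj_mulVec_one (hd : 0 < d) (t : ℕ) : powAdj L t *ᵥ 1 = 1 := by
  ext u
  rw [powAdj_mulVec]
  have : (d : ℝ) ^ t ≠ 0 := by positivity
  simp [this]

theorem normAdj_mulVec_one [DecidableRel G.Adj] (L : EdgeLabelling G d) (hd : 0 < d) :
    normAdj G d *ᵥ 1 = 1 := by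
  ext u
  rw [normAdj_mulVec L]
  have : (d : ℝ) ≠ 0 := by positivity
  simp [this]

theorem powAdj_isHermitian (t : ℕ) : (powAdj L t).IsHermitian := by
  classical
  rw [powAdj_eq]
  exact (normAdj_isHermitian G d).pow t

end PowAdj

/-! ### Unitary operators and approximate orbits -/

section Unitary

variable {X : Type*}

theorem norm_toLp_mulVec_of_mem_unitaryGroup [Fintype X] [DecidableEq X] {M : Matrix X X ℂ}
    (hM : M ∈ Matrix.unitaryGroup X ℂ) (v : X → ℂ) :
    ‖WithLp.toLp 2 (M *ᵥ v)‖ = ‖WithLp.toLp 2 v‖ := by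
  rw [Matrix.mem_unitaryGroup_iff', Matrix.star_eq_conjTranspose] at hM
  have h : star (M *ᵥ v) ⬝ᵥ (M *ᵥ v) = star v ⬝ᵥ v := by
    rw [Matrix.star_mulVec, ← Matrix.dotProduct_mulVec, Matrix.mulVec_mulVec, hM, Matrix.one_mulVec]
  have h2 : ∀ w : X → ℂ, ‖WithLp.toLp 2 w‖ ^ 2 = RCLike.re (star w ⬝ᵥ w) := fun w => by
    rw [← inner_self_eq_norm_sq (𝕜 := ℂ), EuclideanSpace.inner_eq_star_dotProduct,
      dotProduct_comm]
  rw [← sq_eq_sq₀ (norm_nonneg _) (norm_nonneg _), h2, h2, h]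

theorem norm_star_dotProduct_le [Fintype X] (v w : X → ℂ) :
    ‖star v ⬝ᵥ w‖ ≤ ‖WithLp.toLp 2 v‖ * ‖WithLp.toLp 2 w‖ := by
  have := norm_inner_le_norm (𝕜 := ℂ) (WithLp.toLp 2 v) (WithLp.toLp 2 w)
  rwa [EuclideanSpace.inner_eq_star_dotProduct, dotProduct_comm] at this

/-- The errors of an approximate orbit of a unitary operator add up. -/
theorem norm_pow_mulVec_sub_le [Fintype X] [DecidableEq X] {M : Matrix X X ℂ} (hM : M ∈ Matrix.unitaryGroup X ℂ) (v : X → ℂ)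
    (y : ℕ → X → ℂ) (Q : ℕ) :
    ‖WithLp.toLp 2 (M ^ Q *ᵥ v - y Q)‖ ≤ ‖WithLp.toLp 2 (v - y 0)‖ +
      ∑ j ∈ Finset.range Q, ‖WithLp.toLp 2 (M *ᵥ y j - y (j + 1))‖ := by
  induction Q with
  | zero => simp
  | succ Q ih =>
    have h : M ^ (Q + 1) *ᵥ v - y (Q + 1) =
        M *ᵥ (M ^ Q *ᵥ v - y Q) + (M *ᵥ y Q - y (Q + 1)) := by
      rw [Matrix.mulVec_sub, Matrix.mulVec_mulVec, ← pow_succ', sub_add_sub_cancel]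
    rw [h, WithLp.toLp_add, Finset.sum_range_succ, ← add_assoc]
    refine (norm_add_le _ _).trans (add_le_add_left ?_ _)
    rw [norm_toLp_mulVec_of_mem_unitaryGroup hM]
    exact ih

theorem two_smul_sub_one_mem_unitaryGroup [Fintype X] [DecidableEq X] {p : Matrix X X ℂ} (hp : p * p = p) (hs : pᴴ = p) :
    (2 : ℂ) • p - 1 ∈ Matrix.unitaryGroup X ℂ := by
  rw [Matrix.mem_unitaryGroup_iff', Matrix.star_eq_conjTranspose]
  have h : ((2 : ℂ) • p - 1)ᴴ = (2 : ℂ) • p - 1 := by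
    rw [Matrix.conjTranspose_sub, Matrix.conjTranspose_smul, hs]
    simp
  rw [h, sub_mul, mul_sub, smul_mul_smul_comm, hp]
  simp only [mul_one, one_mul]
  module

theorem ketBra_mulVec [Fintype X] (ψ v : X → ℂ) : ketBra ψ *ᵥ v = (star ψ ⬝ᵥ v) • ψ := by
  rw [ketBra, Matrix.vecMulVec_mulVec]
  ext
  simp [mul_comm]

theorem ketBra_conjTranspose (ψ : X → ℂ) : (ketBra ψ)ᴴ = ketBra ψ := by
  rw [ketBra, Matrix.conjTranspose_vecMulVec, star_star]

theorem ketBra_mul_ketBra [Fintype X] (ψ φ : X → ℂ) :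
    ketBra ψ * ketBra φ = (star ψ ⬝ᵥ φ) • Matrix.vecMulVec ψ (star φ) := by
  rw [ketBra, ketBra, Matrix.vecMulVec_mul_vecMulVec, Matrix.vecMulVec_smul]

end Unitary

/-! ### The search operator on lifted functions -/

section Walk

variable {V : Type u}

/-- The isometry that sends a function `f` on the vertices to the state `∑ u, f u |ψ_u⟩`. -/
noncomputable def liftState (d t : ℕ) : (V → ℝ) →ₗ[ℝ] (V × (Fin t → Fin d) → ℂ) where
  toFun f x := (f x.1 : ℂ) * (1 / (Real.sqrt ((d : ℝ) ^ t) : ℂ))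
  map_add' f g := by
    ext x
    simp [add_mul]
  map_smul' c f := by
    ext x
    simp [mul_assoc]

theorem liftState_apply (d t : ℕ) (f : V → ℝ) (x : V × (Fin t → Fin d)) :
    liftState d t f x = (f x.1 : ℂ) * (1 / (Real.sqrt ((d : ℝ) ^ t) : ℂ)) := rfl

variable [Fintype V] [DecidableEq V] {G : SimpleGraph V} {d : ℕ}

theorem psi_eq_liftState (t : ℕ) (m : V) : psi d t m = liftState d t (Pi.single m 1) := by
  ext x
  by_cases h : x.1 = m <;> simp [psi, liftState_apply, h]

theorem startState_eq_liftState (t : ℕ) :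
    startState V d t = liftState d t fun _ => 1 / √(Fintype.card V : ℝ) := by
  ext x
  simp [startState, psi, liftState_apply]

theorem one_div_sqrt_mul_self (hd : 0 < d) (t : ℕ) :
    (1 / (Real.sqrt ((d : ℝ) ^ t) : ℂ)) * (1 / (Real.sqrt ((d : ℝ) ^ t) : ℂ)) =
      1 / (d : ℂ) ^ t := by
  rw [div_mul_div_comm, one_mul, ← Complex.ofReal_mul, Real.mul_self_sqrt (by positivity)]
  simp

theorem star_psi_dotProduct (t : ℕ) (u : V) (v : V × (Fin t → Fin d) → ℂ) :
    star (psi d t u) ⬝ᵥ v = (1 / (Real.sqrt ((d : ℝ) ^ t) : ℂ)) * ∑ g, v (u, g) := by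
  simp only [dotProduct, Fintype.sum_prod_type, Finset.mul_sum]
  rw [Finset.sum_eq_single u]
  · simp [psi]
  · intro w _ hw
    simp [psi, hw]
  · simp

theorem star_psi_dotProduct_liftState (hd : 0 < d) (t : ℕ) (u : V) (f : V → ℝ) :
    star (psi d t u) ⬝ᵥ liftState d t f = f u := by
  have h : (d : ℂ) ^ t ≠ 0 := by
    have : (d : ℂ) ≠ 0 := by exact_mod_cast hd.ne'
    positivity
  rw [star_psi_dotProduct]
  simp only [liftState_apply, Finset.sum_const, Finset.card_univ, Fintype.card_pi,
    Fintype.card_fin, Finset.prod_const, nsmul_eq_mul]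
  rw [mul_left_comm, mul_left_comm (1 / _), one_div_sqrt_mul_self hd]
  push_cast
  field_simp

theorem norm_liftState (hd : 0 < d) (t : ℕ) (f : V → ℝ) :
    ‖WithLp.toLp 2 (liftState d t f)‖ = √(f ⬝ᵥ f) := by
  have hD : (0 : ℝ) < (d : ℝ) ^ t := by positivity
  rw [EuclideanSpace.norm_eq]
  congr 1
  simp only [Fintype.sum_prod_type, liftState_apply, norm_mul, norm_div, norm_one, mul_pow, div_pow,
    Complex.norm_real, Real.norm_eq_abs, sq_abs, Real.sq_sqrt hD.le, Finset.sum_const,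
    Finset.card_univ, Fintype.card_pi, Fintype.card_fin, Finset.prod_const, nsmul_eq_mul,
    dotProduct]
  refine Finset.sum_congr rfl fun u _ => ?_
  push_cast
  field_simp

theorem norm_psi (hd : 0 < d) (t : ℕ) (m : V) : ‖WithLp.toLp 2 (psi d t m)‖ = 1 := by
  rw [psi_eq_liftState, norm_liftState hd]
  simp

theorem norm_startState (hd : 0 < d) (t : ℕ) [Nonempty V] :
    ‖WithLp.toLp 2 (startState V d t)‖ = 1 := by
  rw [startState_eq_liftState, norm_liftState hd]
  have h : (0 : ℝ) < Fintype.card V := by exact_mod_cast Fintype.card_pos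
  simp only [dotProduct, div_mul_div_comm, one_mul, Real.mul_self_sqrt h.le, Finset.sum_const,
    Finset.card_univ, nsmul_eq_mul]
  rw [mul_one_div_cancel h.ne', Real.sqrt_one]

theorem star_psi_dotProduct_psi (hd : 0 < d) (t : ℕ) (u w : V) :
    star (psi d t u) ⬝ᵥ psi d t w = if u = w then 1 else 0 := by
  rw [psi_eq_liftState t w, star_psi_dotProduct_liftState hd, Pi.single_apply]
  split_ifs <;> simp

theorem coinOp_mem_unitaryGroup (hd : 0 < d) (t : ℕ) :
    coinOp V d t ∈ Matrix.unitaryGroup (V × (Fin t → Fin d)) ℂ := by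
  refine two_smul_sub_one_mem_unitaryGroup ?_ ?_
  · rw [Finset.sum_mul_sum]
    refine Finset.sum_congr rfl fun u _ => ?_
    rw [Finset.sum_eq_single u]
    · rw [ketBra_mul_ketBra, star_psi_dotProduct_psi hd, if_pos rfl, one_smul]
      rfl
    · intro w _ hw
      rw [ketBra_mul_ketBra, star_psi_dotProduct_psi hd, if_neg hw.symm, zero_smul]
    · simp
  · rw [Matrix.conjTranspose_sum]
    exact Finset.sum_congr rfl fun u _ => ketBra_conjTranspose _

theorem targetOp_mem_unitaryGroup (hd : 0 < d) (t : ℕ) (m : V) :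
    targetOp d t m ∈ Matrix.unitaryGroup (V × (Fin t → Fin d)) ℂ := by
  have h : (2 : ℂ) • ketBra (psi d t m) - 1 ∈ Matrix.unitaryGroup (V × (Fin t → Fin d)) ℂ := by
    refine two_smul_sub_one_mem_unitaryGroup ?_ (ketBra_conjTranspose _)
    rw [ketBra_mul_ketBra, star_psi_dotProduct_psi hd, if_pos rfl, one_smul]
    rfl
  rw [Matrix.mem_unitaryGroup_iff'] at h ⊢
  rw [targetOp, ← neg_sub, star_neg, neg_mul_neg, h]

variable (L : EdgeLabelling G d)

theorem searchOp_mem_unitaryGroup (hd : 0 < d) (t : ℕ) (m : V) :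
    searchOp L t m ∈ Matrix.unitaryGroup (V × (Fin t → Fin d)) ℂ :=
  mul_mem (mul_mem (basisMap_mem_unitaryGroup (powRotationMap_involutive L t))
    (coinOp_mem_unitaryGroup hd t)) (targetOp_mem_unitaryGroup hd t m)

theorem coinOp_mulVec (t : ℕ) {v : V × (Fin t → Fin d) → ℂ} {h : V → ℝ}
    (hv : ∀ u, star (psi d t u) ⬝ᵥ v = h u) :
    coinOp V d t *ᵥ v = (2 : ℝ) • liftState d t h - v := by
  rw [coinOp, Matrix.sub_mulVec, Matrix.smul_mulVec, Matrix.sum_mulVec, Matrix.one_mulVec]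
  congr 1
  ext x
  simp only [ketBra_mulVec, hv, Pi.smul_apply, Finset.sum_apply, psi, liftState_apply, smul_eq_mul,
    mul_ite, mul_zero]
  simp

theorem targetOp_mulVec (t : ℕ) (m : V) {v : V × (Fin t → Fin d) → ℂ} {c : ℝ}
    (hv : star (psi d t m) ⬝ᵥ v = c) :
    targetOp d t m *ᵥ v = v - (2 * c) • liftState d t (Pi.single m 1) := by
  rw [targetOp, Matrix.sub_mulVec, Matrix.smul_mulVec, Matrix.one_mulVec, ketBra_mulVec, hv,
    psi_eq_liftState]
  congr 1
  ext x
  simp [mul_assoc]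

theorem shiftOp_mulVec_shiftOp_mulVec (t : ℕ) (v : V × (Fin t → Fin d) → ℂ) :
    shiftOp L t *ᵥ (shiftOp L t *ᵥ v) = v := by
  rw [Matrix.mulVec_mulVec, shiftOp, basisMap_mul, (powRotationMap_involutive L t).comp_self,
    basisMap_id, Matrix.one_mulVec]

theorem shiftOp_mulVec_liftState_const (t : ℕ) (c : ℝ) :
    shiftOp L t *ᵥ liftState d t (fun _ => c) = liftState d t fun _ => c := by
  ext x
  rw [shiftOp, basisMap_mulVec (powRotationMap_involutive L t)]
  rfl

/-- The discriminant of the walk is the normalized adjacency matrix of the powered graph. -/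
theorem star_psi_dotProduct_shiftOp (hd : 0 < d) (t : ℕ) (u : V) (f : V → ℝ) :
    star (psi d t u) ⬝ᵥ (shiftOp L t *ᵥ liftState d t f) = ((powAdj L t *ᵥ f) u : ℝ) := by
  rw [star_psi_dotProduct, powAdj_mulVec]
  simp only [shiftOp, basisMap_mulVec (powRotationMap_involutive L t), liftState_apply,
    ← Finset.sum_mul]
  rw [mul_left_comm, one_div_sqrt_mul_self hd]
  push_cast
  ring

/-- The oracle maps lifts to lifts and the coin fixes them, so only the shift remains. Together with
`searchOp_mulVec_shiftOp` this shows that `U` preserves the span of the lifts and their shifts. -/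
theorem searchOp_mulVec_liftState (hd : 0 < d) (t : ℕ) (m : V) (f : V → ℝ) :
    searchOp L t m *ᵥ liftState d t f = shiftOp L t *ᵥ liftState d t f -
      (2 * f m) • (shiftOp L t *ᵥ liftState d t (Pi.single m 1)) := by
  have hW : ∀ f : V → ℝ, walkOp L t *ᵥ liftState d t f = shiftOp L t *ᵥ liftState d t f :=
    fun f => by
      rw [walkOp, ← Matrix.mulVec_mulVec,
        coinOp_mulVec t fun u => star_psi_dotProduct_liftState hd t u f, two_smul, add_sub_cancel_right]
  rw [searchOp, ← Matrix.mulVec_mulVec,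
    targetOp_mulVec t m (star_psi_dotProduct_liftState hd t m f), Matrix.mulVec_sub,
    Matrix.mulVec_smul, hW, hW]

/-- The coin reflects through the space of lifts, and by `star_psi_dotProduct_shiftOp` the
projection of a shifted lift is the lift of `powAdj L t *ᵥ f`; the second shift undoes the first. -/
theorem searchOp_mulVec_shiftOp (hd : 0 < d) (t : ℕ) (m : V) (f : V → ℝ) :
    searchOp L t m *ᵥ (shiftOp L t *ᵥ liftState d t f) =
      (2 : ℝ) • (shiftOp L t *ᵥ liftState d t (powAdj L t *ᵥ f)) - liftState d t f -
      (2 * (powAdj L t *ᵥ f) m) • (shiftOp L t *ᵥ liftState d t (Pi.single m 1)) := by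
  rw [searchOp, ← Matrix.mulVec_mulVec,
    targetOp_mulVec t m (star_psi_dotProduct_shiftOp L hd t m f), Matrix.mulVec_sub,
    Matrix.mulVec_smul, walkOp, ← Matrix.mulVec_mulVec, ← Matrix.mulVec_mulVec,
    coinOp_mulVec t fun u => star_psi_dotProduct_shiftOp L hd t u f,
    coinOp_mulVec t fun u => star_psi_dotProduct_liftState hd t u _, two_smul ℝ (liftState d t (Pi.single m 1)),
    add_sub_cancel_right, Matrix.mulVec_sub, Matrix.mulVec_smul, shiftOp_mulVec_shiftOp_mulVec]

/-- The amplitude of the target state grows at most linearly. -/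
theorem successProb_le (hd : 0 < d) [Nonempty V] (t : ℕ) (m : V) (Q : ℕ) :
    successProb L t m Q ≤ ((2 * Q + 1) * (1 / √(Fintype.card V : ℝ))) ^ 2 := by
  set r := 1 / √(Fintype.card V : ℝ) with hr
  have hr0 : 0 ≤ r := by positivity
  have hU := searchOp_mem_unitaryGroup L hd t m
  have hstep : searchOp L t m *ᵥ startState V d t - startState V d t =
      -(2 * r) • (shiftOp L t *ᵥ psi d t m) := by
    rw [startState_eq_liftState, searchOp_mulVec_liftState L hd, shiftOp_mulVec_liftState_const,
      psi_eq_liftState]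
    module
  have hnorm : ‖WithLp.toLp 2 (searchOp L t m *ᵥ startState V d t - startState V d t)‖ = 2 * r := by
    rw [hstep, WithLp.toLp_smul, norm_smul, shiftOp, norm_toLp_mulVec_of_mem_unitaryGroup
      (basisMap_mem_unitaryGroup (powRotationMap_involutive L t)), norm_psi hd, mul_one, norm_neg,
      Real.norm_of_nonneg (by positivity)]
  have h := norm_pow_mulVec_sub_le hU (startState V d t) (fun _ => startState V d t) Q
  simp only [sub_self, WithLp.toLp_zero, norm_zero, zero_add, hnorm, Finset.sum_const,
    Finset.card_range, nsmul_eq_mul] at h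
  have h2 := norm_star_dotProduct_le (psi d t m)
    (searchOp L t m ^ Q *ᵥ startState V d t - startState V d t)
  rw [norm_psi hd, one_mul, dotProduct_sub] at h2
  have h3 : ‖star (psi d t m) ⬝ᵥ startState V d t‖ = r := by
    rw [startState_eq_liftState, star_psi_dotProduct_liftState hd, Complex.norm_real,
      Real.norm_of_nonneg hr0]
  rw [successProb]
  refine pow_le_pow_left₀ (norm_nonneg _) ?_ 2
  have h4 := norm_sub_norm_le (star (psi d t m) ⬝ᵥ (searchOp L t m ^ Q *ᵥ startState V d t))
    (star (psi d t m) ⬝ᵥ startState V d t)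
  linarith

/-- The amplitude of the target state in the early iterations, in terms of the solution of the
Poisson equation of the powered graph. -/
theorem le_norm_amplitude (hd : 0 < d) [Nonempty V] (t : ℕ) (m : V) {f : V → ℝ} {r k : ℝ}
    (hr : r = 1 / √(Fintype.card V : ℝ)) (hf : f - powAdj L t *ᵥ f =
      fun u => ((if u = m then 1 else 0) - 1 / (Fintype.card V : ℝ)) / 2)
    (hk : 0 ≤ k) (hkf : 2 * k * f m = 1) (Q : ℕ) :
    k * (Q * r) - k * (Q * r) ^ 2 - 2 * k * r * √(f ⬝ᵥ f) ≤
      ‖star (psi d t m) ⬝ᵥ ((searchOp L t m) ^ Q *ᵥ startState V d t)‖ := by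
  have hN : (0 : ℝ) < Fintype.card V := by exact_mod_cast Fintype.card_pos
  have hr0 : 0 ≤ r := by rw [hr]; positivity
  have hr2 : r * r = 1 / (Fintype.card V : ℝ) := by
    rw [hr, div_mul_div_comm, one_mul, Real.mul_self_sqrt hN.le]
  have hU := searchOp_mem_unitaryGroup L hd t m
  have hPf : powAdj L t *ᵥ f =
      f - (1 / 2 : ℝ) • Pi.single m 1 + (r / 2) • fun _ => r := by
    ext u
    have := congrFun hf u
    rw [← hr2] at this
    simp only [Pi.sub_apply] at this
    simp only [Pi.add_apply, Pi.sub_apply, Pi.smul_apply, Pi.single_apply, smul_eq_mul]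
    linarith
  have hPfm : (powAdj L t *ᵥ f) m = f m - 1 / 2 + r * r / 2 := by
    rw [hPf]
    simp
    ring
  have hstart : startState V d t = liftState d t fun _ => r := by
    rw [startState_eq_liftState, hr]
  set A := liftState d t f with hA
  set B := shiftOp L t *ᵥ liftState d t f with hB
  set Ψ := startState V d t with hΨ
  set D := shiftOp L t *ᵥ liftState d t (Pi.single m 1) with hD
  have hUA : searchOp L t m *ᵥ A = B - (2 * f m) • D := searchOp_mulVec_liftState L hd t m f
  have hUΨ : searchOp L t m *ᵥ Ψ = Ψ - (2 * r) • D := by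
    rw [hstart, searchOp_mulVec_liftState L hd, shiftOp_mulVec_liftState_const]
  have hUB : searchOp L t m *ᵥ B = (2 : ℝ) • (B - (1 / 2 : ℝ) • D + (r / 2) • Ψ) - A -
      (2 * (f m - 1 / 2 + r * r / 2)) • D := by
    rw [hB, searchOp_mulVec_shiftOp L hd, hPfm, hPf, map_add, map_sub, map_smul, map_smul,
      Matrix.mulVec_add, Matrix.mulVec_sub, Matrix.mulVec_smul, Matrix.mulVec_smul,
      shiftOp_mulVec_liftState_const, hstart]
  -- The approximate orbit. The choice `2 * k * f m = 1` cancels the terms in `D` when `U` acts on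
  -- `Ψ - (2 * k * r) • A`; on the vector multiplied by `j` they cancel by the Poisson equation.
  let y : ℕ → V × (Fin t → Fin d) → ℂ := fun j =>
    (Ψ - (2 * k * r) • A) + (k * (j * r)) • ((2 : ℝ) • A - (2 : ℝ) • B + r • Ψ)
  have hstep : ∀ j : ℕ, searchOp L t m *ᵥ y j - y (j + 1) = -(k * r ^ 2 * (2 * j + 1)) • Ψ := by
    intro j
    have hUA' : searchOp L t m *ᵥ ((2 * k * r) • A) = (2 * k * r) • B - (2 * r) • D := by
      rw [Matrix.mulVec_smul, hUA, smul_sub, smul_smul]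
      congr 2
      linear_combination 2 * r * hkf
    simp only [y, Matrix.mulVec_add, Matrix.mulVec_sub, hUA']
    simp only [Matrix.mulVec_add, Matrix.mulVec_sub, Matrix.mulVec_smul, hUA, hUB, hUΨ]
    push_cast
    module
  have hΨ1 : ‖WithLp.toLp 2 Ψ‖ = 1 := norm_startState hd t
  have herr := norm_pow_mulVec_sub_le hU Ψ y Q
  have h0 : Ψ - y 0 = (2 * k * r) • A := by simp [y]
  -- The odd numbers `2j + 1` with `j < Q` add up to `Q²`.
  have hsum : ∑ j ∈ Finset.range Q, ‖WithLp.toLp 2 (searchOp L t m *ᵥ y j - y (j + 1))‖ =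
      k * (Q * r) ^ 2 := by
    have : ∀ j : ℕ, ‖WithLp.toLp 2 (searchOp L t m *ᵥ y j - y (j + 1))‖ =
        k * r ^ 2 * (2 * j + 1) := fun j => by
      rw [hstep, WithLp.toLp_smul, norm_smul, hΨ1, mul_one, norm_neg,
        Real.norm_of_nonneg (by positivity)]
    simp only [this]
    clear herr
    induction Q with
    | zero => simp
    | succ Q ih =>
      rw [Finset.sum_range_succ, ih]
      push_cast
      ring
  rw [hsum, h0, WithLp.toLp_smul, norm_smul, norm_liftState hd,
    Real.norm_of_nonneg (by positivity)] at herr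
  have h2 := norm_star_dotProduct_le (psi d t m) (searchOp L t m ^ Q *ᵥ Ψ - y Q)
  rw [norm_psi hd, one_mul, dotProduct_sub] at h2
  have hy : star (psi d t m) ⬝ᵥ y Q = ((k * (Q * r) : ℝ) : ℂ) := by
    have hmA : star (psi d t m) ⬝ᵥ A = (f m : ℂ) := star_psi_dotProduct_liftState hd t m f
    have hmB : star (psi d t m) ⬝ᵥ B = ((f m - 1 / 2 + r * r / 2 : ℝ) : ℂ) := by
      rw [hB, star_psi_dotProduct_shiftOp L hd, hPfm]
    have hmΨ : star (psi d t m) ⬝ᵥ Ψ = (r : ℂ) := by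
      rw [hstart, star_psi_dotProduct_liftState hd]
    simp only [y, dotProduct_add, dotProduct_sub, dotProduct_smul, hmA, hmB, hmΨ,
      Complex.real_smul, ← Complex.ofReal_mul, ← Complex.ofReal_add, ← Complex.ofReal_sub]
    congr 1
    linear_combination (-r) * hkf
  rw [hy] at h2
  have h4 := norm_sub_norm_le ((k * (Q * r) : ℝ) : ℂ)
    (star (psi d t m) ⬝ᵥ (searchOp L t m ^ Q *ᵥ Ψ))
  rw [norm_sub_rev, Complex.norm_real, Real.norm_of_nonneg (by positivity)] at h4
  linarith

end Walk

/-! ### Order `√N` iterations suffice and are necessary -/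

section Search

variable {V : Type u} [Fintype V] [DecidableEq V] {G : SimpleGraph V} {d : ℕ}
  (L : EdgeLabelling G d)

/-- When the powered graph has a constant gap, of order `√N` iterations reach a constant success
probability simultaneously for all marked vertices. -/
theorem exists_le_successProb (hd : 0 < d) (hc : 1 < Fintype.card V) (t : ℕ) {γ : ℝ} (hγ : 0 < γ)
    (hg : γ ≤ spectralGap (powAdj L t)) (hN4 : 4 ≤ √(Fintype.card V : ℝ))
    (hNγ : 64 / γ ^ 2 ≤ √(Fintype.card V : ℝ)) :
    ∃ Q : ℕ, (Q : ℝ) ≤ √(Fintype.card V : ℝ) / 2 ∧ ∀ m : V, γ ^ 2 / 64 ≤ successProb L t m Q := by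
  have : Nonempty V := Fintype.card_pos_iff.1 (by omega)
  set s := √(Fintype.card V : ℝ) with hs
  have hs0 : 0 < s := by linarith
  -- Then `q = Q / s` lies in `[1/4, 1/2]`, where `q - q² ≥ 3/16`. The amplitude is at least `3γ/16`
  -- minus an initial error of at most `γ/16`, that is `γ/8`.
  set Q := ⌈s / 4⌉₊ with hQ
  have hQ1 : s / 4 ≤ Q := Nat.le_ceil _
  have hQ2 : (Q : ℝ) ≤ s / 2 := by
    have := Nat.ceil_lt_add_one (a := s / 4) (by positivity)
    linarith
  refine ⟨Q, hQ2, fun m => ?_⟩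
  have hM := powAdj_isHermitian L t
  have h1 := powAdj_mulVec_one L hd t
  obtain ⟨f, hf1, hf⟩ := exists_poisson_solution hM hc h1 (hγ.trans_le hg) m
  obtain ⟨hf0, hfγ, hF⟩ := poisson_solution_bounds hM hc h1 (powAdj_nonneg L t) hγ hg hf1 hf
  set k := 1 / (2 * f m) with hk
  have hk0 : 0 < k := by positivity
  have hkf : 2 * k * f m = 1 := by rw [hk]; field_simp
  have hkγ : γ ≤ k := by
    rw [hk, le_div_iff₀ (by positivity)]
    rw [le_div_iff₀ (by positivity)] at hfγ
    linarith
  have hamp := le_norm_amplitude L hd t m (r := 1 / s) rfl hf hk0.le hkf Q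
  have hq1 : 1 / 4 ≤ (Q : ℝ) * (1 / s) := by
    rw [mul_one_div, le_div_iff₀ hs0]
    linarith
  have hq2 : (Q : ℝ) * (1 / s) ≤ 1 / 2 := by
    rw [mul_one_div, div_le_iff₀ hs0]
    linarith
  set q := (Q : ℝ) * (1 / s) with hq
  have hmain : 3 / 16 * γ ≤ k * q - k * q ^ 2 := by
    have : 3 / 16 ≤ q - q ^ 2 := by nlinarith
    nlinarith
  have herr : 2 * k * (1 / s) * √(f ⬝ᵥ f) ≤ γ / 16 := by
    calc 2 * k * (1 / s) * √(f ⬝ᵥ f) ≤ 2 * k * (1 / s) * (4 / γ * f m) := by gcongr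
      _ = 4 / γ * (1 / s) := by linear_combination (4 / γ * (1 / s)) * hkf
      _ ≤ γ / 16 := by
        rw [div_mul_div_comm, mul_one, div_le_iff₀ (by positivity)]
        rw [div_le_iff₀ (by positivity)] at hNγ
        nlinarith
  have hfin : γ / 8 ≤ ‖star (psi d t m) ⬝ᵥ ((searchOp L t m) ^ Q *ᵥ startState V d t)‖ := by
    linarith
  rw [successProb]
  calc γ ^ 2 / 64 = (γ / 8) ^ 2 := by ring
    _ ≤ _ := pow_le_pow_left₀ (by positivity) hfin 2

/-- A success probability `p` needs of order `√N` iterations. -/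
theorem le_of_le_successProb (hd : 0 < d) (t : ℕ) (m : V) {p : ℝ} (hp : 0 < p)
    (hNp : 2 / √p ≤ √(Fintype.card V : ℝ)) {Q : ℕ} (hQ : p ≤ successProb L t m Q) :
    √p / 4 * √(Fintype.card V : ℝ) ≤ Q := by
  have : Nonempty V := ⟨m⟩
  have hsp : 0 < √p := Real.sqrt_pos.2 hp
  have hs0 : 0 < √(Fintype.card V : ℝ) := (by positivity : 0 < 2 / √p).trans_le hNp
  have h := Real.sqrt_le_sqrt (hQ.trans (successProb_le L hd t m Q))
  rw [Real.sqrt_sq (by positivity), mul_one_div, le_div_iff₀ hs0] at h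
  rw [div_le_iff₀ hsp] at hNp
  -- From `√p * √N ≤ 2Q + 1`; the lower bound on `N` makes `1` at most half of the left side.
  nlinarith

end Search

/-! ### Choice of the walk length, and numerical estimates -/

theorem exists_odd_mem_Icc {g : ℝ} (hg : 0 < g) (hg2 : g ≤ 2) :
    ∃ t : ℕ, Odd t ∧ 1 / g ≤ (t : ℝ) ∧ (t : ℝ) ≤ 3 / g := by
  rcases le_or_gt g 1 with h | h
  -- Here `[1/g, 3/g]` has length at least `2` and so contains an odd integer; for `1 < g ≤ 2` it
  -- contains `1`.
  · have hx : 1 ≤ 1 / g := by rwa [le_div_iff₀ hg, one_mul]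
    have h3 : 3 / g = 3 * (1 / g) := by ring
    rw [h3]
    set x := 1 / g with hxdef
    refine ⟨2 * ⌈(x - 1) / 2⌉₊ + 1, ⟨_, rfl⟩, ?_, ?_⟩
    · have := Nat.le_ceil ((x - 1) / 2)
      push_cast
      linarith
    · have := Nat.ceil_lt_add_one (a := (x - 1) / 2) (by linarith)
      push_cast
      linarith
  · refine ⟨1, odd_one, ?_, ?_⟩
    · rw [div_le_iff₀ hg]
      push_cast
      linarith
    · rw [le_div_iff₀ hg]
      push_cast
      linarith

theorem one_sub_pow_le_exp_neg {g c : ℝ} {t : ℕ} (ht : Odd t) (hg : 0 < g)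
    (hc : c / g ≤ t) : (1 - g) ^ t ≤ Real.exp (-c) := by
  rcases le_or_gt g 1 with h | h
  · have hct : c ≤ t * g := by rwa [div_le_iff₀ hg] at hc
    calc (1 - g) ^ t ≤ Real.exp (-g) ^ t := by
          refine pow_le_pow_left₀ (by linarith) ?_ t
          have := Real.add_one_le_exp (-g)
          linarith
      _ = Real.exp (-(t * g)) := by rw [← Real.exp_nat_mul]; ring_nf
      _ ≤ Real.exp (-c) := Real.exp_le_exp.2 (by linarith)
  -- The second eigenvalue may be negative, as for complete graphs; then its odd power is not
  -- positive.
  · exact (ht.pow_nonpos (by linarith)).trans (Real.exp_pos _).le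

theorem logb_two_le_clog {n : ℕ} (hn : 0 < n) : Real.logb 2 n ≤ Nat.clog 2 n := by
  rw [Real.logb_le_iff_le_rpow (by norm_num) (by exact_mod_cast hn), Real.rpow_natCast]
  exact_mod_cast Nat.le_pow_clog (by norm_num) n

/-- Rounding up costs at most `1`, which is at most `logb 2 n` once `n ≥ 2`; at `n = 1` both sides
vanish. -/
theorem clog_le_two_mul_logb {n : ℕ} (hn : 0 < n) : (Nat.clog 2 n : ℝ) ≤ 2 * Real.logb 2 n := by
  rcases Nat.lt_or_ge n 2 with h | h
  · obtain rfl : n = 1 := by omega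
    simp
  · have h1 := Nat.pow_pred_clog_lt_self (b := 2) (by norm_num) (x := n) (by omega)
    have hpos : 0 < Nat.clog 2 n := Nat.clog_pos (by norm_num) h
    have h2 : ((Nat.clog 2 n - 1 : ℕ) : ℝ) ≤ Real.logb 2 n := by
      rw [Real.le_logb_iff_rpow_le (by norm_num) (by positivity), Real.rpow_natCast]
      exact_mod_cast h1.le
    have h3 : (1 : ℝ) ≤ Real.logb 2 n := by
      rw [Real.le_logb_iff_rpow_le (by norm_num) (by positivity), Real.rpow_one]
      exact_mod_cast h
    rw [Nat.cast_sub hpos, Nat.cast_one] at h2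
    linarith

theorem qubitCount_bounds {c₁ c₂ g : ℝ} {n d t : ℕ} (hc₁ : 0 < c₁) (hc : c₁ ≤ c₂) (hg : 0 < g)
    (hg2 : g ≤ 2) (hd : 0 < d) (hdn : d ≤ n) (ht₁ : c₁ / g ≤ t) (ht₂ : t ≤ c₂ / g) :
    min 1 c₁ * (Real.logb 2 n + Real.logb 2 d / g) ≤ (qubitCount n d t : ℝ) ∧
      (qubitCount n d t : ℝ) ≤ (4 + 2 * c₂) * (Real.logb 2 n + Real.logb 2 d / g) ∧
      (qubitCount n d t : ℝ) ≤ (4 + 2 * c₂) * (Real.logb 2 n / g) := by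
  have hd1 : (1 : ℝ) ≤ d := by exact_mod_cast hd
  have hdn' : (d : ℝ) ≤ n := by exact_mod_cast hdn
  have hld : 0 ≤ Real.logb 2 d := Real.logb_nonneg (by norm_num) hd1
  have hle : Real.logb 2 d ≤ Real.logb 2 n :=
    Real.logb_le_logb_of_le (by norm_num) (by linarith) hdn'
  have n1 := logb_two_le_clog (hd.trans_le hdn)
  have n2 := clog_le_two_mul_logb (hd.trans_le hdn)
  have d1 := logb_two_le_clog hd
  have d2 := clog_le_two_mul_logb hd
  set x := Real.logb 2 n with hx
  set y := Real.logb 2 d with hy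
  have hq : (qubitCount n d t : ℝ) = Nat.clog 2 n + t * Nat.clog 2 d := by
    simp [qubitCount]
  have hyg : 0 ≤ y / g := by positivity
  have ht0 : (0 : ℝ) ≤ t := t.cast_nonneg
  have hup : (t : ℝ) * Nat.clog 2 d ≤ 2 * c₂ * (y / g) := by
    calc (t : ℝ) * Nat.clog 2 d ≤ c₂ / g * (2 * y) :=
          mul_le_mul ht₂ d2 (Nat.cast_nonneg _) (ht0.trans ht₂)
      _ = 2 * c₂ * (y / g) := by ring
  have hlow : c₁ * (y / g) ≤ (t : ℝ) * Nat.clog 2 d := by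
    calc c₁ * (y / g) = c₁ / g * y := by ring
      _ ≤ _ := mul_le_mul ht₁ d1 hld ht0
  have hc₂ : 0 < c₂ := hc₁.trans_le hc
  have hx0 : 0 ≤ x := hld.trans hle
  rw [hq]
  refine ⟨?_, ?_, ?_⟩
  · have h1 := mul_le_mul_of_nonneg_right (min_le_left 1 c₁) hx0
    have h2 := mul_le_mul_of_nonneg_right (min_le_right 1 c₁) hyg
    linarith
  · nlinarith [mul_nonneg hc₂.le hx0]
  -- Since `g ≤ 2`; this is where the `4` in the constant comes from, the vertex register taking at
  -- most `2x` qubits.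
  · have hxg : x ≤ 2 * (x / g) := by
      rw [mul_div_assoc', le_div_iff₀ hg]
      nlinarith
    have hyx : y / g ≤ x / g := by gcongr
    nlinarith

/-! ### Assembly of the constants -/

theorem mainTheorem10 :
    -- odd walk lengths of order `1 / g` exist
    (∀ (V : Type u) [Fintype V] [DecidableEq V] (G : SimpleGraph V) [DecidableRel G.Adj] (d : ℕ),
      0 < d → 2 ≤ Fintype.card V → G.IsRegularOfDegree d → 0 < spectralGap (normAdj G d) →
      ∃ t : ℕ, Odd t ∧ 1 / spectralGap (normAdj G d) ≤ (t : ℝ) ∧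
        (t : ℝ) ≤ 3 / spectralGap (normAdj G d)) ∧
    -- for all of them the claims hold, with constants that depend on `c₁`, `c₂` (and `p`) only
    (∀ c₁ c₂ : ℝ, 0 < c₁ → c₁ ≤ c₂ →
      ∃ γ κ₁ κ₂ p₀ : ℝ, 0 < γ ∧ 0 < κ₁ ∧ 0 < κ₂ ∧ 0 < p₀ ∧
      ∀ p : ℝ, 0 < p → p ≤ p₀ →
      ∃ (a b : ℝ) (N₀ : ℕ), 0 < a ∧ 0 < b ∧
      ∀ (V : Type u) [Fintype V] [DecidableEq V] (G : SimpleGraph V) [DecidableRel G.Adj]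
        (d : ℕ) (L : EdgeLabelling G d) (t : ℕ) (g N : ℝ),
        0 < d → 2 ≤ Fintype.card V → G.IsRegularOfDegree d →
        g = spectralGap (normAdj G d) → 0 < g → N = (Fintype.card V : ℝ) →
        Odd t → c₁ / g ≤ (t : ℝ) → (t : ℝ) ≤ c₂ / g →
        -- the gap of the powered graph is of constant order
        (powAdj L t = normAdj G d ^ t ∧
          1 - spectralGap (powAdj L t) = (1 - g) ^ t ∧
          γ ≤ spectralGap (powAdj L t) ∧ spectralGap (powAdj L t) ≤ 2) ∧
        -- the circuit performs the iterations of the search operator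
        (∀ (Q : ℕ) (m : V), circuitOp L m (searchCircuit t Q) = searchOp L t m ^ Q) ∧
        -- query complexities, for the least number of iterations with success probability `≥ p`
        (N₀ ≤ Fintype.card V →
          ∃ Q : ℕ, IsLeast {Q : ℕ | ∀ m : V, p ≤ successProb L t m Q} Q ∧
            a * √N ≤ (targetCalls (searchCircuit t Q) : ℝ) ∧
            (targetCalls (searchCircuit t Q) : ℝ) ≤ b * √N ∧
            a * (√N / g) ≤ (graphCalls (searchCircuit t Q) : ℝ) ∧
            (graphCalls (searchCircuit t Q) : ℝ) ≤ b * (√N / g)) ∧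
        -- number of qubits
        (κ₁ * (Real.logb 2 N + Real.logb 2 d / g) ≤ (qubitCount (Fintype.card V) d t : ℝ) ∧
          (qubitCount (Fintype.card V) d t : ℝ) ≤ κ₂ * (Real.logb 2 N + Real.logb 2 d / g) ∧
          (qubitCount (Fintype.card V) d t : ℝ) ≤ κ₂ * (Real.logb 2 N / g))) := by
  refine ⟨?_, ?_⟩
  · intro V _ _ G _ d hd hc hreg hg
    -- Some labelling is chosen only to obtain that the row sums are one.
    have L : EdgeLabelling G d := fun u => Fintype.equivOfCardEq (by
      rw [Fintype.card_fin, G.card_neighborSet_eq_degree, hreg u])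
    exact exists_odd_mem_Icc hg (spectralGap_le_two (normAdj_isHermitian G d) hc
      (normAdj_mulVec_one L hd) fun u v => by
        simp only [normAdj, Matrix.of_apply]
        positivity)
  intro c₁ c₂ hc₁ hc₁₂
  have hc₂ : 0 < c₂ := hc₁.trans_le hc₁₂
  set γ := 1 - Real.exp (-c₁) with hγdef
  have hγ : 0 < γ := by
    have : Real.exp (-c₁) < 1 := by simpa using hc₁
    linarith
  refine ⟨γ, min 1 c₁, 4 + 2 * c₂, γ ^ 2 / 64, hγ, lt_min one_pos hc₁, by positivity,
    by positivity, fun p hp hpγ => ?_⟩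
  have hsp : 0 < √p := Real.sqrt_pos.2 hp
  -- `√p / 4` and `1 / 2` bound `Q / √N`; the factors `min 1 c₁` and `max 1 c₂` let the same
  -- constants serve `Q * t`. The threshold for `N` puts `√N` above all three lower bounds required
  -- by the search lemmas.
  refine ⟨√p / 4 * min 1 c₁, max 1 c₂ / 2, ⌈(4 + 64 / γ ^ 2 + 2 / √p) ^ 2⌉₊,
    mul_pos (by positivity) (lt_min one_pos hc₁),
    half_pos (one_pos.trans_le (le_max_left _ _)), ?_⟩
  rintro V _ _ G _ d L t g N hd hc hreg hgdef hg rfl ht ht₁ ht₂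
  have hA := normAdj_isHermitian G d
  have hpow := powAdj_eq L t
  have hgap : 1 - spectralGap (powAdj L t) = (1 - g) ^ t := by
    rw [hpow, one_sub_spectralGap_pow hA hc ht, hgdef]
  have hγg : γ ≤ spectralGap (powAdj L t) := by
    have := one_sub_pow_le_exp_neg ht hg ht₁
    linarith
  have hg2 : g ≤ 2 := by
    rw [hgdef]
    refine spectralGap_le_two hA hc (normAdj_mulVec_one L hd) fun u v => ?_
    simp only [normAdj, Matrix.of_apply]
    positivity
  have hgt2 : spectralGap (powAdj L t) ≤ 2 :=
    spectralGap_le_two (powAdj_isHermitian L t) hc (powAdj_mulVec_one L hd t) (powAdj_nonneg L t)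
  obtain ⟨m₀⟩ : Nonempty V := Fintype.card_pos_iff.1 (by omega)
  have hdn : d ≤ Fintype.card V := by
    rw [← hreg m₀]
    exact (G.degree_lt_card_verts m₀).le
  refine ⟨⟨hpow, hgap, hγg, hgt2⟩, fun Q m => circuitOp_searchCircuit L m Q, fun hN₀ => ?_,
    qubitCount_bounds hc₁ hc₁₂ hg hg2 hd hdn ht₁ ht₂⟩
  have hs : 4 + 64 / γ ^ 2 + 2 / √p ≤ √(Fintype.card V : ℝ) :=
    Real.le_sqrt_of_sq_le (Nat.ceil_le.1 hN₀)
  have hγ64 : 0 < 64 / γ ^ 2 := by positivity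
  have hp2 : 0 < 2 / √p := by positivity
  obtain ⟨Q₁, hQ₁, hQ₁p⟩ :=
    exists_le_successProb L hd hc t hγ hγg (by linarith) (by linarith)
  have hmem : Q₁ ∈ {Q : ℕ | ∀ m : V, p ≤ successProb L t m Q} := fun m => hpγ.trans (hQ₁p m)
  have hleast : IsLeast {Q : ℕ | ∀ m : V, p ≤ successProb L t m Q}
      (sInf {Q : ℕ | ∀ m : V, p ≤ successProb L t m Q}) :=
    ⟨Nat.sInf_mem ⟨Q₁, hmem⟩, fun _ h => Nat.sInf_le h⟩
  set Q := sInf {Q : ℕ | ∀ m : V, p ≤ successProb L t m Q} with hQdef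
  set s := √(Fintype.card V : ℝ) with hsdef
  have hQ2 : (Q : ℝ) ≤ s / 2 := le_trans (by exact_mod_cast hleast.2 hmem) hQ₁
  have hQ1 : √p / 4 * s ≤ Q := le_of_le_successProb L hd t m₀ hp (by linarith) (hleast.1 m₀)
  have hs0 : 0 < s := by linarith
  refine ⟨Q, hleast, ?_⟩
  rw [targetCalls_searchCircuit, graphCalls_searchCircuit, Nat.cast_mul]
  refine ⟨?_, ?_, ?_, ?_⟩
  · calc √p / 4 * min 1 c₁ * s ≤ √p / 4 * 1 * s := by gcongr; exact min_le_left _ _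
      _ ≤ Q := by rwa [mul_one]
  · calc (Q : ℝ) ≤ 1 / 2 * s := by linarith
      _ ≤ max 1 c₂ / 2 * s := by gcongr; exact le_max_left _ _
  · calc √p / 4 * min 1 c₁ * (s / g) ≤ √p / 4 * c₁ * (s / g) := by
          gcongr; exact min_le_right _ _
      _ = √p / 4 * s * (c₁ / g) := by ring
      _ ≤ Q * t := by gcongr
  · calc (Q : ℝ) * t ≤ s / 2 * (c₂ / g) := by gcongr
      _ = c₂ / 2 * (s / g) := by ring
      _ ≤ max 1 c₂ / 2 * (s / g) := by gcongr; exact le_max_right _ _
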